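/- All graphs are finite and simple. For a graph $G$, let $\rho(G)$ be the largest eigenvalue of its adjacency matrix. $K_s$ denotes the complete graph and $I_s$ the edgeless graph on $s$ vertices, $+$ denotes the disjoint union, and $G_1\vee G_2$ denotes the join, obtained from $G_1+G_2$ by adding all edges between $V(G_1)$ and $V(G_2)$. A graph is $m$-connected if it has more than $m$ vertices and it remains connected whenever fewer than $m$ vertices are deleted. Let $m\ge 1$ and $k\ge 2$ be integers, and let $G$ be an $m$-connected graph of order $$n\ \ge\ \max\left\{(7k-2)m+4,\ (k-1)m^2+\tfrac12(3k+1)m+\tfrac92\right\}.$$ If $$\rho(G)\ \ge\ \rho\bigl(K_m\vee(K_{n-km-1}+I_{km-m+1})\bigr),$$ then $G$ has a spanning tree of maximum degree at most $k$, unless $G$ is isomorphic to $K_m\vee(K_{n-km-1}+I_{km-m+1})$, in which case $G$ has no such spanning tree. -/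

import Mathlib

namespace SpanningKTree

/-- The join `G ∨ H`: the disjoint union of `G` and `H` together with all edges between
the two vertex sets. -/
def join {V W : Type*} (G : SimpleGraph V) (H : SimpleGraph W) : SimpleGraph (V ⊕ W) :=
  (G ⊕g H) ⊔ completeBipartiteGraph V W

/-- The graph `K_m ∨ (K_a + I_b)`, where `I_b` is the edgeless graph on `b` vertices and `+` is
the disjoint union. -/
def joinGraph (m a b : ℕ) : SimpleGraph (Fin m ⊕ (Fin a ⊕ Fin b)) :=
  join (⊤ : SimpleGraph (Fin m)) ((⊤ : SimpleGraph (Fin a)) ⊕g (⊥ : SimpleGraph (Fin b)))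

open Classical in
/-- The largest eigenvalue of the adjacency matrix of a finite graph with at least one vertex. -/
noncomputable def specRadius {V : Type*} [Fintype V] (G : SimpleGraph V) : ℝ :=
  sSup {μ : ℝ | Module.End.HasEigenvalue (Matrix.toLin' (G.adjMatrix ℝ)) μ}

/-- `G` is `m`-connected: it has more than `m` vertices, and it stays connected whenever fewer
than `m` vertices are deleted. -/
def IsMConnected {V : Type*} [Fintype V] (G : SimpleGraph V) (m : ℕ) : Prop :=
  m < Fintype.card V ∧
    ∀ S : Finset V, S.card < m → (G.induce {v : V | v ∉ S}).Connected

open Classical in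
/-- `G` has a spanning tree in which every vertex has degree at most `k`. -/
def HasSpanningKTree {V : Type*} [Fintype V] (G : SimpleGraph V) (k : ℕ) : Prop :=
  ∃ T : SimpleGraph V, T ≤ G ∧ T.IsTree ∧ ∀ v : V, T.degree v ≤ k

end SpanningKTree

/-! Suppose `G` has no spanning tree of maximum degree at most `k`. Put `b = (k-1)m+1`, `N = n-b`,
and call `K_m ∨ (K_(N-m) + I_b)` the extremal graph. It contains `K_N`, so the spectral hypothesis
gives `ρ(G) ≥ N-1`, and Hong's bound (`sq_eigenvalue_add_le`) turns this into a large edge count.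
Enlarge `G` to an edge-maximal `G'` without such a tree. Adding any missing edge `uv` creates one;
deleting `uv` from it leaves two rooted trees, and exchanging edges inside them shows `d(u) + d(v) ≤
n - (k-2)m - 2` (`degree_add_degree_le_of_hasSpanningKTree_sup_edge`). Connectivity enters because
the vertices that resist the exchange separate `u` from `v`, so there are at least `m` of them. This
degree condition and the edge count force `G'` to be extremal (`exists_structure_of_closed`). Thus
`G ≤ G'` with `ρ(G) ≥ ρ(G')`, and strict monotonicity of `ρ` below a connected graph
(`eq_of_specRadius_le`) yields `G = G'`. Conversely, the extremal graph has no such tree: too many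
vertices would need a parent in `K_m` (`not_hasSpanningKTree_joinGraph`). -/

namespace SpanningKTree

open Finset SimpleGraph
open scoped Classical

section

variable {V : Type*}

/-! ### Rooted forests through parent functions -/

/-- A parent function and a height function for the component of `u` in `F`, rooted at `u`. -/
structure IsParent (F : SimpleGraph V) (u : V) (p : V → V) (h : V → ℕ) : Prop where
  adj : ∀ z, F.Reachable u z → z ≠ u → F.Adj z (p z)
  lt : ∀ z, F.Reachable u z → z ≠ u → h (p z) < h z

lemma exists_isParent (F : SimpleGraph V) (u : V) : ∃ p h, IsParent F u p h := by
  have key : ∀ z, ∃ y, F.Reachable u z → z ≠ u → F.Adj z y ∧ F.dist u y < F.dist u z := by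
    intro z
    by_cases hz : F.Reachable u z
    · by_cases hzu : z = u
      · exact ⟨z, fun _ h => absurd hzu h⟩
      · obtain ⟨w, hw⟩ := hz.symm.exists_walk_length_eq_dist
        cases w with
        | nil => exact absurd rfl hzu
        | @cons _ y _ hadj w' =>
          refine ⟨y, fun _ _ => ⟨hadj, ?_⟩⟩
          have h1 := F.dist_le w'
          rw [SimpleGraph.Walk.length_cons] at hw
          rw [F.dist_comm (u := u) (v := y), F.dist_comm (u := u) (v := z)]
          omega
    · exact ⟨z, fun h => absurd h hz⟩
  choose p hp using key
  exact ⟨p, F.dist u, fun z h1 h2 => (hp z h1 h2).1, fun z h1 h2 => (hp z h1 h2).2⟩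

lemma IsParent.reachable {F : SimpleGraph V} {u : V} {p : V → V} {h : V → ℕ}
    (hp : IsParent F u p h) {z : V} (hz : F.Reachable u z) (hzu : z ≠ u) :
    F.Reachable u (p z) :=
  hz.trans (hp.adj z hz hzu).reachable

/-- If every vertex of the component is joined in `C` to its parent or to the root, then
every vertex of the component reaches the root in `C`. -/
lemma IsParent.climb {F C : SimpleGraph V} {u : V} {p : V → V} {h : V → ℕ}
    (hp : IsParent F u p h)
    (hC : ∀ z, F.Reachable u z → z ≠ u → C.Adj z (p z) ∨ C.Adj z u) :
    ∀ z, F.Reachable u z → C.Reachable u z := by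
  intro z
  induction hn : h z using Nat.strong_induction_on generalizing z with
  | _ n ih =>
    intro hz
    by_cases hzu : z = u
    · rw [hzu]
    · rcases hC z hz hzu with h1 | h1
      · exact (ih _ (hn ▸ hp.lt z hz hzu) (p z) rfl (hp.reachable hz hzu)).trans
          h1.symm.reachable
      · exact h1.symm.reachable

/-- If neither end were the parent of the other, every parent edge would survive the deletion of
`xc`, leaving `x` and `c` connected although `xc` is a bridge. -/
lemma IsParent.eq_or_eq {F : SimpleGraph V} (hF : F.IsAcyclic) {u : V} {p : V → V} {h : V → ℕ}
    (hp : IsParent F u p h) {x c : V} (hx : F.Reachable u x) (hxc : F.Adj x c) :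
    (x ≠ u ∧ p x = c) ∨ (c ≠ u ∧ p c = x) := by
  by_contra hcon
  push Not at hcon
  have hb := isAcyclic_iff_forall_adj_isBridge.1 hF hxc
  rw [isBridge_iff] at hb
  have hcl := hp.climb (C := F.deleteEdges {s(x, c)}) (by
    intro z hz hzu
    left
    rw [deleteEdges_adj]
    refine ⟨hp.adj z hz hzu, ?_⟩
    rw [Set.mem_singleton_iff, Sym2.eq_iff]
    rintro (⟨rfl, h2⟩ | ⟨rfl, h2⟩)
    · exact hcon.1 hzu h2
    · exact hcon.2 hzu h2)
  exact hb ((hcl x hx).symm.trans (hcl c (hx.trans hxc.reachable)))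

variable [Fintype V]

/-- The neighbours of a vertex, as a finset. -/
noncomputable def nbrs (G : SimpleGraph V) (v : V) : Finset V := univ.filter (G.Adj v)

@[simp] lemma mem_nbrs {G : SimpleGraph V} {v w : V} : w ∈ nbrs G v ↔ G.Adj v w := by
  simp [nbrs]

lemma card_nbrs (G : SimpleGraph V) (v : V) [Fintype (G.neighborSet v)] :
    #(nbrs G v) = G.degree v := by
  rw [← card_neighborFinset_eq_degree]
  congr 1
  ext w
  simp

lemma nbrs_mono {G H : SimpleGraph V} (h : G ≤ H) (v : V) : nbrs G v ⊆ nbrs H v := by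
  intro w
  simpa using fun hw => h hw

/-! ### Edge exchange and the degree condition -/

/-- The vertex set of the component of `u`. -/
noncomputable def side (F : SimpleGraph V) (u : V) : Finset V := univ.filter (F.Reachable u)

@[simp] lemma mem_side {F : SimpleGraph V} {u w : V} : w ∈ side F u ↔ F.Reachable u w := by
  simp [side]

/-- A connected subgraph of `G` on the vertex set `side F u`, of maximum degree at most `k`, in
which `x` has degree less than `k`. -/
def HasSlackAt (G F : SimpleGraph V) (k : ℕ) (u x : V) : Prop :=
  ∃ C : SimpleGraph V, C ≤ G ∧ (∀ a b, C.Adj a b → F.Reachable u a) ∧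
    (∀ z, F.Reachable u z → C.Reachable u z) ∧ (∀ z, #(nbrs C z) ≤ k) ∧ #(nbrs C x) + 1 ≤ k

/-- `X` consists of the saturated `x ≠ u` none of whose children is a `G`-neighbour of `u`. Each has
at least `k-1` children, and these are distinct, differ from `u` and avoid the neighbours of `u`;
this is the count. A saturated `x` outside `X` has a child `c` adjacent to `u`, and replacing `xc`
by `uc` frees a degree at `x` at the cost of the spare one at `u`. -/
lemma exists_blocked_set {G F : SimpleGraph V} (hFG : F ≤ G) (hF : F.IsAcyclic) {k : ℕ} {u : V}
    (hdeg : ∀ z, #(nbrs F z) ≤ k) (hu : #(nbrs F u) + 1 ≤ k) :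
    ∃ X ⊆ side F u, u ∉ X ∧
      #(nbrs G u ∩ side F u) + (k - 1) * #X + 1 ≤ #(side F u) ∧
      ∀ x ∈ side F u, x ∉ X → HasSlackAt G F k u x := by
  obtain ⟨p, h, hp⟩ := exists_isParent F u
  set child : V → Finset V := fun x => (side F u).filter (fun c => c ≠ u ∧ p c = x) with hchild
  set X := (side F u).filter
    (fun x => x ≠ u ∧ #(nbrs F x) = k ∧ ∀ c ∈ child x, ¬ G.Adj u c) with hX
  have hcard : ∀ x ∈ X, k - 1 ≤ #(child x) := by
    intro x hx
    simp only [hX, mem_filter, mem_side] at hx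
    have hsub : nbrs F x ⊆ insert (p x) (child x) := by
      intro c hc
      rw [mem_nbrs] at hc
      rcases hp.eq_or_eq hF hx.1 hc with h1 | h1
      · exact mem_insert.2 (Or.inl h1.2.symm)
      · refine mem_insert_of_mem ?_
        simp only [hchild, mem_filter, mem_side]
        exact ⟨hx.1.trans hc.reachable, h1⟩
    have h1 := (card_le_card hsub).trans (card_insert_le _ _)
    have := hx.2.2.1
    omega
  refine ⟨X, filter_subset _ _, by simp [hX], ?_, ?_⟩
  · have hdisj : ((X : Set V)).PairwiseDisjoint child := by
      intro a _ b _ hab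
      rw [Function.onFun, Finset.disjoint_left]
      intro c hc hc'
      simp only [hchild, mem_filter] at hc hc'
      exact hab (hc.2.2.symm.trans hc'.2.2)
    have hU : (k - 1) * #X ≤ #(X.biUnion child) := by
      rw [card_biUnion hdisj, mul_comm, ← smul_eq_mul]
      exact card_nsmul_le_sum _ _ _ hcard
    have hd1 : Disjoint (nbrs G u ∩ side F u) (X.biUnion child) := by
      rw [Finset.disjoint_left]
      intro c hc hc'
      rw [mem_biUnion] at hc'
      obtain ⟨x, hx, hcx⟩ := hc'
      simp only [hX, mem_filter] at hx
      exact hx.2.2.2 c hcx (mem_nbrs.1 (mem_inter.1 hc).1)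
    have hsub : insert u ((nbrs G u ∩ side F u) ∪ X.biUnion child) ⊆ side F u := by
      intro c hc
      rcases mem_insert.1 hc with rfl | hc
      · simp
      rcases mem_union.1 hc with hc | hc
      · exact (mem_inter.1 hc).2
      · obtain ⟨x, _, hcx⟩ := mem_biUnion.1 hc
        exact (mem_filter.1 hcx).1
    have hnot : u ∉ (nbrs G u ∩ side F u) ∪ X.biUnion child := by
      simp [hchild]
    have := card_le_card hsub
    rw [card_insert_of_notMem hnot, card_union_of_disjoint hd1] at this
    omega
  · intro x hx hxX
    rw [mem_side] at hx
    -- The restriction of `F` to the component of `u`.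
    set FA : SimpleGraph V :=
      { Adj := fun a b => F.Adj a b ∧ F.Reachable u a
        symm := ⟨fun a b hab => ⟨hab.1.symm, hab.2.trans hab.1.reachable⟩⟩
        loopless := ⟨fun a ha => F.loopless.irrefl a ha.1⟩ } with hFA
    have hFAF : FA ≤ F := fun a b hab => hab.1
    by_cases hfull : #(nbrs F x) = k
    · have hxu : x ≠ u := by rintro rfl; omega
      have : ∃ c ∈ child x, G.Adj u c := by
        by_contra hno
        push Not at hno
        exact hxX (by simp only [hX, mem_filter, mem_side]; exact ⟨hx, hxu, hfull, hno⟩)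
      obtain ⟨c, hc, huc⟩ := this
      simp only [hchild, mem_filter, mem_side] at hc
      obtain ⟨hcr, hcu, hpc⟩ := hc
      have hcx : F.Adj c x := hpc ▸ hp.adj c hcr hcu
      refine ⟨FA.deleteEdges {s(x, c)} ⊔ edge u c, ?_, ?_, ?_, ?_, ?_⟩
      · refine sup_le ((deleteEdges_le _).trans (hFAF.trans hFG)) ?_
        rw [edge_le_iff]; exact Or.inr huc
      · intro a b hab
        rw [sup_adj, deleteEdges_adj, edge_adj] at hab
        rcases hab with hab | ⟨⟨rfl, rfl⟩ | ⟨rfl, rfl⟩, _⟩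
        · exact hab.1.2
        · exact Reachable.refl _
        · exact hcr
      · refine hp.climb ?_
        intro z hz hzu
        by_cases hzc : z = c
        · right
          rw [sup_adj, edge_adj]
          right; exact ⟨Or.inr ⟨hzc, rfl⟩, hzu⟩
        · left
          rw [sup_adj, deleteEdges_adj]
          left
          refine ⟨⟨hp.adj z hz hzu, hz⟩, ?_⟩
          rw [Set.mem_singleton_iff, Sym2.eq_iff]
          rintro (⟨rfl, h2⟩ | ⟨h1, h2⟩)
          -- Here `c` would be the parent of `x` and `x` that of `c`, against the decrease of
          -- heights.
          · have h3 := hp.lt z hz hzu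
            have h4 := hp.lt c hcr hcu
            rw [h2] at h3; rw [hpc] at h4
            omega
          · exact hzc h1
      · intro z
        by_cases hzu : z = u
        · subst hzu
          have : nbrs (FA.deleteEdges {s(x, c)} ⊔ edge z c) z ⊆ insert c (nbrs F z) := by
            intro w hw
            rw [mem_nbrs, sup_adj, deleteEdges_adj, edge_adj] at hw
            rcases hw with hw | ⟨⟨_, rfl⟩ | ⟨rfl, rfl⟩, hne⟩
            · exact mem_insert_of_mem (mem_nbrs.2 hw.1.1)
            · exact mem_insert_self _ _
            · exact absurd rfl hne
          exact (card_le_card this).trans ((card_insert_le _ _).trans hu)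
        by_cases hzc : z = c
        · subst hzc
          have : nbrs (FA.deleteEdges {s(x, z)} ⊔ edge u z) z ⊆ insert u ((nbrs F z).erase x) := by
            intro w hw
            rw [mem_nbrs, sup_adj, deleteEdges_adj, edge_adj] at hw
            rcases hw with hw | ⟨⟨rfl, rfl⟩ | ⟨_, rfl⟩, hne⟩
            · refine mem_insert_of_mem (mem_erase.2 ⟨?_, mem_nbrs.2 hw.1.1⟩)
              rintro rfl
              exact hw.2 (by simp [Sym2.eq_swap])
            · exact absurd rfl hne
            · exact mem_insert_self _ _
          refine (card_le_card this).trans ((card_insert_le _ _).trans ?_)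
          rw [card_erase_of_mem (mem_nbrs.2 hcx)]
          have := card_pos.2 ⟨x, mem_nbrs.2 hcx⟩
          have := hdeg z
          omega
        · have : nbrs (FA.deleteEdges {s(x, c)} ⊔ edge u c) z ⊆ nbrs F z := by
            intro w hw
            rw [mem_nbrs, sup_adj, deleteEdges_adj, edge_adj] at hw
            rcases hw with hw | ⟨⟨rfl, rfl⟩ | ⟨rfl, rfl⟩, hne⟩
            · exact mem_nbrs.2 hw.1.1
            · exact absurd rfl hzu
            · exact absurd rfl hzc
          exact (card_le_card this).trans (hdeg z)
      · have : nbrs (FA.deleteEdges {s(x, c)} ⊔ edge u c) x ⊆ (nbrs F x).erase c := by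
          intro w hw
          rw [mem_nbrs, sup_adj, deleteEdges_adj, edge_adj] at hw
          rcases hw with hw | ⟨⟨rfl, rfl⟩ | ⟨rfl, rfl⟩, hne⟩
          · refine mem_erase.2 ⟨?_, mem_nbrs.2 hw.1.1⟩
            rintro rfl
            exact hw.2 (by simp)
          · exact absurd rfl hxu
          · exact absurd hcx (F.loopless.irrefl _)
        have h1 := card_le_card this
        rw [card_erase_of_mem (mem_nbrs.2 hcx.symm)] at h1
        have := card_pos.2 ⟨c, mem_nbrs.2 hcx.symm⟩
        omega
    · refine ⟨FA, hFAF.trans hFG, fun a b hab => hab.2, ?_, ?_, ?_⟩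
      · exact hp.climb fun z hz hzu => Or.inl ⟨hp.adj z hz hzu, hz⟩
      · exact fun z => (card_le_card (nbrs_mono hFAF z)).trans (hdeg z)
      · have := card_le_card (nbrs_mono hFAF x)
        have := hdeg x
        omega

lemma hasSpanningKTree_iff {G : SimpleGraph V} {k : ℕ} :
    HasSpanningKTree G k ↔ ∃ T : SimpleGraph V, T ≤ G ∧ T.IsTree ∧ ∀ v, #(nbrs T v) ≤ k := by
  simp only [HasSpanningKTree, card_nbrs]

/-- Degree bounds pass to spanning subgraphs, so constructions need not keep track of acyclicity. -/
lemma hasSpanningKTree_of_connected {G C : SimpleGraph V} {k : ℕ} (hCG : C ≤ G)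
    (hC : C.Connected) (hdeg : ∀ v, #(nbrs C v) ≤ k) : HasSpanningKTree G k := by
  obtain ⟨T, hTC, hT⟩ := hC.exists_isTree_le
  exact hasSpanningKTree_iff.2
    ⟨T, hTC.trans hCG, hT, fun v => (card_le_card (nbrs_mono hTC v)).trans (hdeg v)⟩

/-- `P` marks a union of components of `G - S` that contains `a` and misses `b`. -/
lemma IsMConnected.le_card_of_separates {G : SimpleGraph V} {m : ℕ} (hG : IsMConnected G m)
    {S : Finset V} {P : V → Prop} {a b : V} (ha : a ∉ S) (hb : b ∉ S) (hPa : P a) (hPb : ¬ P b)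
    (hsep : ∀ x y, x ∉ S → y ∉ S → P x → G.Adj x y → P y) : m ≤ #S := by
  by_contra hlt
  push Not at hlt
  have hc := hG.2 S hlt
  obtain ⟨w⟩ := hc.preconnected ⟨a, ha⟩ ⟨b, hb⟩
  have key : ∀ (x y : {v : V | v ∉ S}), (G.induce {v : V | v ∉ S}).Walk x y → P x.1 → P y.1 := by
    intro x y w
    induction w with
    | nil => exact id
    | @cons x z y hxz _ ih => exact fun hx => ih (hsep x.1 z.1 x.2 z.2 hx hxz)
  exact hPb (key _ _ w hPa)

lemma IsMConnected.mono {G H : SimpleGraph V} {m : ℕ} (hG : IsMConnected G m) (h : G ≤ H) :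
    IsMConnected H m :=
  ⟨hG.1, fun S hS => (hG.2 S hS).mono fun _ _ hab => h hab⟩

lemma IsMConnected.connected {G : SimpleGraph V} {m : ℕ} (hG : IsMConnected G m) (hm : 1 ≤ m) :
    G.Connected := by
  have hne : Nonempty V := Fintype.card_pos_iff.1 (by have := hG.1; omega)
  refine ⟨fun a b => ?_⟩
  by_contra hab
  have := hG.le_card_of_separates (S := ∅) (P := G.Reachable a) (a := a) (b := b)
    (by simp) (by simp) (Reachable.refl _) hab (fun x y _ _ hx hxy => hx.trans hxy.reachable)
  simp at this
  omega

lemma IsMConnected.le_card_nbrs {G : SimpleGraph V} {m : ℕ} (hG : IsMConnected G m) (v : V) :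
    m ≤ #(nbrs G v) := by
  by_contra hlt
  push Not at hlt
  have h1 : #(insert v (nbrs G v)) < #(univ : Finset V) := by
    have := card_insert_le v (nbrs G v)
    have := hG.1
    rw [card_univ]
    omega
  obtain ⟨b, _, hb⟩ := exists_mem_notMem_of_card_lt_card h1
  rw [mem_insert, not_or] at hb
  have := hG.le_card_of_separates (S := nbrs G v) (P := fun x => x = v) (a := v) (b := b)
    (by simp) hb.2 rfl hb.1 (by
      rintro x y _ hy rfl hxy
      exact absurd (mem_nbrs.2 hxy) hy)
  omega

/-- Both ends of `xy` have a degree to spare, so `xy` can link the two rebuilt halves. -/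
lemma hasSpanningKTree_of_slack {G F : SimpleGraph V} {k : ℕ} {u v x y : V}
    (hA : ∀ z, F.Reachable u z ∨ F.Reachable v z) (hdisj : ¬ F.Reachable u v)
    (hxu : F.Reachable u x) (hyv : F.Reachable v y)
    (hx : HasSlackAt G F k u x) (hy : HasSlackAt G F k v y) (hxy : G.Adj x y) :
    HasSpanningKTree G k := by
  obtain ⟨C, hCG, hCs, hCr, hCd, hCx⟩ := hx
  obtain ⟨D, hDG, hDs, hDr, hDd, hDy⟩ := hy
  have hno : ∀ z, F.Reachable u z → ¬ F.Reachable v z := fun z h1 h2 => hdisj (h1.trans h2.symm)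
  refine hasSpanningKTree_of_connected (C := C ⊔ D ⊔ edge x y) ?_ ?_ ?_
  · refine sup_le (sup_le hCG hDG) ?_
    rw [edge_le_iff]; exact Or.inr hxy
  · have huv : (C ⊔ D ⊔ edge x y).Reachable u v := by
      have h1 := (hCr x hxu).mono (le_sup_left.trans le_sup_left : C ≤ C ⊔ D ⊔ edge x y)
      have h2 := (hDr y hyv).mono (le_sup_right.trans le_sup_left : D ≤ C ⊔ D ⊔ edge x y)
      have h3 : (C ⊔ D ⊔ edge x y).Adj x y := by
        rw [sup_adj, edge_adj]; right; exact ⟨Or.inl ⟨rfl, rfl⟩, hxy.ne⟩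
      exact (h1.trans h3.reachable).trans h2.symm
    have hall : ∀ z, (C ⊔ D ⊔ edge x y).Reachable u z := by
      intro z
      rcases hA z with h | h
      · exact (hCr z h).mono (le_sup_left.trans le_sup_left)
      · exact huv.trans ((hDr z h).mono (le_sup_right.trans le_sup_left))
    have : Nonempty V := ⟨u⟩
    exact ⟨fun a b => (hall a).symm.trans (hall b)⟩
  · intro z
    rcases hA z with h | h
    · have hyz : z ≠ y := by rintro rfl; exact hno _ h hyv
      by_cases hzx : z = x
      · subst hzx
        have : nbrs (C ⊔ D ⊔ edge z y) z ⊆ insert y (nbrs C z) := by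
          intro w hw
          rw [mem_nbrs, sup_adj, sup_adj, edge_adj] at hw
          rcases hw with (hw | hw) | ⟨⟨_, rfl⟩ | ⟨rfl, rfl⟩, hne⟩
          · exact mem_insert_of_mem (mem_nbrs.2 hw)
          · exact absurd (hDs _ _ hw) (hno _ h)
          · exact mem_insert_self _ _
          · exact absurd rfl hne
        exact (card_le_card this).trans ((card_insert_le _ _).trans hCx)
      · have : nbrs (C ⊔ D ⊔ edge x y) z ⊆ nbrs C z := by
          intro w hw
          rw [mem_nbrs, sup_adj, sup_adj, edge_adj] at hw
          rcases hw with (hw | hw) | ⟨⟨rfl, _⟩ | ⟨rfl, _⟩, hne⟩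
          · exact mem_nbrs.2 hw
          · exact absurd (hDs _ _ hw) (hno _ h)
          · exact absurd rfl hzx
          · exact absurd rfl hyz
        exact (card_le_card this).trans (hCd z)
    · have hxz : z ≠ x := by rintro rfl; exact hno _ hxu h
      have h' : ¬ F.Reachable u z := fun h' => hno _ h' h
      by_cases hzy : z = y
      · subst hzy
        have : nbrs (C ⊔ D ⊔ edge x z) z ⊆ insert x (nbrs D z) := by
          intro w hw
          rw [mem_nbrs, sup_adj, sup_adj, edge_adj] at hw
          rcases hw with (hw | hw) | ⟨⟨rfl, rfl⟩ | ⟨_, rfl⟩, hne⟩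
          · exact absurd (hCs _ _ hw) h'
          · exact mem_insert_of_mem (mem_nbrs.2 hw)
          · exact absurd rfl hne
          · exact mem_insert_self _ _
        exact (card_le_card this).trans ((card_insert_le _ _).trans hDy)
      · have : nbrs (C ⊔ D ⊔ edge x y) z ⊆ nbrs D z := by
          intro w hw
          rw [mem_nbrs, sup_adj, sup_adj, edge_adj] at hw
          rcases hw with (hw | hw) | ⟨⟨rfl, _⟩ | ⟨rfl, _⟩, hne⟩
          · exact absurd (hCs _ _ hw) h'
          · exact mem_nbrs.2 hw
          · exact absurd rfl hxz
          · exact absurd rfl hzy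
        exact (card_le_card this).trans (hDd z)

/-- The degree condition at a nonadjacent pair whose addition creates a spanning `k`-tree. -/
theorem degree_add_degree_le_of_hasSpanningKTree_sup_edge {G : SimpleGraph V} {m k : ℕ}
    (hk : 2 ≤ k) (hG : IsMConnected G m) (hno : ¬ HasSpanningKTree G k) {u v : V}
    (huv : ¬ G.Adj u v) (hT : HasSpanningKTree (G ⊔ edge u v) k) :
    #(nbrs G u) + #(nbrs G v) + (k - 2) * m + 2 ≤ Fintype.card V := by
  obtain ⟨T, hTG, hTtree, hTdeg⟩ := hasSpanningKTree_iff.1 hT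
  have hTuv : T.Adj u v := by
    by_contra hnot
    refine hno (hasSpanningKTree_iff.2 ⟨T, fun a b hab => ?_, hTtree, hTdeg⟩)
    have := hTG hab
    rw [sup_adj, edge_adj] at this
    rcases this with h | ⟨⟨rfl, rfl⟩ | ⟨rfl, rfl⟩, _⟩
    · exact h
    · exact absurd hab hnot
    · exact absurd hab.symm hnot
  set F := T.deleteEdges {s(u, v)} with hF
  have hFT : F ≤ T := deleteEdges_le _
  have hFG : F ≤ G := by
    intro a b hab
    rw [hF, deleteEdges_adj, Set.mem_singleton_iff, Sym2.eq_iff] at hab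
    have := hTG hab.1
    rw [sup_adj, edge_adj] at this
    rcases this with h | h
    · exact h
    · exact absurd h.1 (fun h' => hab.2 (by tauto))
  have hFac : F.IsAcyclic := hTtree.isAcyclic.anti hFT
  have hdisj : ¬ F.Reachable u v := by
    have hb := isAcyclic_iff_forall_adj_isBridge.1 hTtree.isAcyclic hTuv
    rwa [isBridge_iff] at hb
  have hA : ∀ z, F.Reachable u z ∨ F.Reachable v z := by
    intro z
    obtain ⟨w⟩ := hTtree.connected.preconnected u z
    have key : ∀ a b, T.Walk a b → (F.Reachable u a ∨ F.Reachable v a) →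
        (F.Reachable u b ∨ F.Reachable v b) := by
      intro a b w
      induction w with
      | nil => exact id
      | @cons a c b hac _ ih =>
        intro h
        apply ih
        by_cases hF' : F.Adj a c
        · exact h.imp (fun h => h.trans hF'.reachable) (fun h => h.trans hF'.reachable)
        · rw [hF, deleteEdges_adj, Set.mem_singleton_iff, Sym2.eq_iff] at hF'
          have : (a = u ∧ c = v) ∨ (a = v ∧ c = u) := by tauto
          rcases this with ⟨_, rfl⟩ | ⟨_, rfl⟩
          · exact Or.inr (Reachable.refl _)
          · exact Or.inl (Reachable.refl _)
    exact key _ _ w (Or.inl (Reachable.refl _))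
  have hFdeg : ∀ z, #(nbrs F z) ≤ k := fun z => (card_le_card (nbrs_mono hFT z)).trans (hTdeg z)
  have hFu : #(nbrs F u) + 1 ≤ k := by
    refine (Nat.succ_le_of_lt (card_lt_card ?_)).trans (hTdeg u)
    refine (ssubset_iff_of_subset (nbrs_mono hFT u)).2 ⟨v, mem_nbrs.2 hTuv, ?_⟩
    simp [hF]
  have hFv : #(nbrs F v) + 1 ≤ k := by
    refine (Nat.succ_le_of_lt (card_lt_card ?_)).trans (hTdeg v)
    refine (ssubset_iff_of_subset (nbrs_mono hFT v)).2 ⟨u, mem_nbrs.2 hTuv.symm, ?_⟩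
    simp [hF, Sym2.eq_swap]
  obtain ⟨X, hXs, huX, hXc, hX⟩ := exists_blocked_set hFG hFac hFdeg hFu
  obtain ⟨Y, hYs, hvY, hYc, hY⟩ := exists_blocked_set hFG hFac hFdeg hFv
  have hcross : ∀ x y, F.Reachable u x → F.Reachable v y → x ∉ X → y ∉ Y → ¬ G.Adj x y :=
    fun x y hx hy hxX hyY hxy => hno (hasSpanningKTree_of_slack hA hdisj hx hy
      (hX x (mem_side.2 hx) hxX) (hY y (mem_side.2 hy) hyY) hxy)
  have huY : u ∉ Y := fun h => hdisj (mem_side.1 (hYs h)).symm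
  have hvX : v ∉ X := fun h => hdisj (mem_side.1 (hXs h))
  -- An edge between unblocked vertices of the two sides would give a spanning tree, so `X ∪ Y`
  -- separates `u` from `v`.
  have hm : m ≤ #(X ∪ Y) := by
    refine hG.le_card_of_separates (P := F.Reachable u) (a := u) (b := v) ?_ ?_
      (Reachable.refl _) hdisj ?_
    · simp [huX, huY]
    · simp [hvX, hvY]
    · intro x y hx hy hux hxy
      by_contra huy
      have hvy := (hA y).resolve_left huy
      rw [mem_union, not_or] at hx hy
      exact hcross x y hux hvy hx.1 hy.2 hxy
  have hXY : m ≤ #X + #Y := hm.trans (card_union_le _ _)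
  have hsides : #(side F u) + #(side F v) = Fintype.card V := by
    rw [← card_union_of_disjoint, ← card_univ]
    · congr 1
      ext z
      simpa using hA z
    · rw [Finset.disjoint_left]
      intro z h1 h2
      exact hdisj ((mem_side.1 h1).trans (mem_side.1 h2).symm)
  -- As `u` is unblocked, its neighbours on the other side all lie in `Y`. This costs one copy of
  -- `#Y`, which is why `k - 1` drops to `k - 2`.
  have hu : #(nbrs G u) ≤ #(nbrs G u ∩ side F u) + #Y := by
    refine (card_le_card (fun z hz => ?_)).trans (card_union_le _ _)
    rw [mem_union, mem_inter, mem_side]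
    rcases hA z with h | h
    · exact Or.inl ⟨hz, h⟩
    · right
      by_contra hzY
      exact hcross u z (Reachable.refl _) h huX hzY (mem_nbrs.1 hz)
  have hv : #(nbrs G v) ≤ #(nbrs G v ∩ side F v) + #X := by
    refine (card_le_card (fun z hz => ?_)).trans (card_union_le _ _)
    rw [mem_union, mem_inter, mem_side]
    rcases hA z with h | h
    · right
      by_contra hzX
      exact hcross z v h (Reachable.refl _) hzX hvY (mem_nbrs.1 hz).symm
    · exact Or.inl ⟨hz, h⟩
  obtain ⟨l, rfl⟩ : ∃ l, k = l + 2 := ⟨k - 2, by omega⟩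
  have e1 : l + 2 - 1 = l + 1 := by omega
  have e2 : l + 2 - 2 = l := by omega
  rw [e1] at hXc hYc
  rw [e2]
  have := Nat.mul_le_mul_left l hXY
  nlinarith

/-! ### Edge counting and the structure of dense closed graphs -/

/-- Every edge has both ends outside `W` or is counted by the degrees in `W`. -/
lemma sum_card_nbrs_add_le (G : SimpleGraph V) (W : Finset V) :
    ∑ v, #(nbrs G v) + #Wᶜ ≤ #Wᶜ * #Wᶜ + 2 * ∑ w ∈ W, #(nbrs G w) := by
  have h1 : ∀ x ∈ Wᶜ, #(nbrs G x) + 1 ≤ #Wᶜ + #(W.filter (G.Adj x)) := by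
    intro x hx
    have hsub : insert x (nbrs G x) ⊆ Wᶜ ∪ W.filter (G.Adj x) := by
      intro y hy
      rw [mem_union, mem_filter, mem_compl]
      rcases mem_insert.1 hy with rfl | hy
      · exact Or.inl (mem_compl.1 hx)
      · by_cases hyW : y ∈ W
        · exact Or.inr ⟨hyW, mem_nbrs.1 hy⟩
        · exact Or.inl hyW
    have := (card_le_card hsub).trans (card_union_le _ _)
    rwa [card_insert_of_notMem (by simp)] at this
  have h2 : ∑ x ∈ Wᶜ, #(W.filter (G.Adj x)) ≤ ∑ w ∈ W, #(nbrs G w) := by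
    have := sum_card_bipartiteAbove_eq_sum_card_bipartiteBelow (s := Wᶜ) (t := W) G.Adj
    simp only [bipartiteAbove, bipartiteBelow] at this
    rw [this]
    refine sum_le_sum fun w _ => card_le_card fun x hx => ?_
    exact mem_nbrs.2 (mem_filter.1 hx).2.symm
  have h3 := sum_le_sum h1
  rw [sum_add_distrib, sum_add_distrib, sum_const, sum_const, smul_eq_mul, smul_eq_mul] at h3
  have h4 := sum_add_sum_compl W (fun v => #(nbrs G v))
  omega

/-- The difference of the two sides is a convex quadratic in `t`, so it suffices that it is negative
at the ends of `1 ≤ t ≤ (N-m-1)/2`. `h1` handles the left end, `h2` the right one. -/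
lemma edge_count_lt {N b m t : ℤ} (hm : 1 ≤ m) (hb : m + 1 ≤ b)
    (h1 : 2 * b * m + b + 2 * m + 6 ≤ 2 * N) (h2 : 6 * b + 5 * m ≤ N + 3)
    (ht : 1 ≤ t) (ht' : 2 * t + m + 1 ≤ N) :
    (N - t) * (N - t) + 2 * ((b + t) * (m + t)) < N * N + b - t := by
  obtain ⟨T, rfl⟩ : ∃ T, N = T + m + 1 := ⟨N - m - 1, by ring⟩
  have g1 : 4 + 2 * b * m + b + 2 * m - 2 * (T + m + 1) < 0 := by linarith
  have g2 : - T ^ 2 + 2 * T * (2 * b - 1) + 8 * b * m - 4 * b < 0 := by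
    have hT : 6 * b + 4 * m - 4 ≤ T := by linarith
    nlinarith [mul_le_mul hT (show 2 * b + 4 * m - 2 ≤ T - 4 * b + 2 by linarith)
      (by linarith) (by linarith), mul_pos (show 0 < b by linarith) (show 0 < m by linarith)]
  have hT : 2 < T := by linarith
  -- Convex interpolation between the values at `t = 1` and `t = T/2` (the latter scaled by 4); the
  -- last term is the convexity defect.
  have e : 2 * (T - 2) * (3 * t ^ 2 + t * (1 + 2 * b + 2 * m - 2 * (T + m + 1)) + 2 * b * m - b) =
      2 * (T - 2 * t) * (4 + 2 * b * m + b + 2 * m - 2 * (T + m + 1)) +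
      (t - 1) * (- T ^ 2 + 2 * T * (2 * b - 1) + 8 * b * m - 4 * b) -
      3 * (t - 1) * (T - 2 * t) * (T - 2) := by ring
  have p1 : 0 ≤ (T - 2 * t) * -(4 + 2 * b * m + b + 2 * m - 2 * (T + m + 1)) :=
    mul_nonneg (by linarith) (by linarith)
  have p2 : 0 ≤ (t - 1) * -(- T ^ 2 + 2 * T * (2 * b - 1) + 8 * b * m - 4 * b) :=
    mul_nonneg (by linarith) (by linarith)
  have p3 : 0 ≤ (t - 1) * (T - 2 * t) * (T - 2) :=
    mul_nonneg (mul_nonneg (by linarith) (by linarith)) (by linarith)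
  have hneg : 3 * t ^ 2 + t * (1 + 2 * b + 2 * m - 2 * (T + m + 1)) + 2 * b * m - b < 0 := by
    rcases eq_or_lt_of_le ht with rfl | ht1
    · linarith
    · have p4 : 0 < (t - 1) * -(- T ^ 2 + 2 * T * (2 * b - 1) + 8 * b * m - 4 * b) :=
        mul_pos (by linarith) (by linarith)
      by_contra hcon
      push Not at hcon
      have := mul_nonneg (show 0 ≤ 2 * (T - 2) by linarith) hcon
      linarith
  linarith

/-- A dense graph satisfying the closure condition is the join of `K_m` with
`K_(N-m) + I_b`. -/
theorem exists_structure_of_closed {G : SimpleGraph V} {N b m : ℕ} (hm : 1 ≤ m) (hb : m + 1 ≤ b)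
    (hn : Fintype.card V = N + b) (hG : IsMConnected G m) (hG' : ∃ u v, u ≠ v ∧ ¬ G.Adj u v)
    (h1 : 2 * b * m + b + 2 * m + 6 ≤ 2 * N) (h2 : 6 * b + 5 * m ≤ N + 3)
    (hcl : ∀ u v, u ≠ v → ¬ G.Adj u v → #(nbrs G u) + #(nbrs G v) + 1 ≤ N + m)
    (hsum : N * N + b ≤ ∑ v, #(nbrs G v) + N) :
    ∃ S W : Finset V, Disjoint S W ∧ #S = m ∧ #W = b ∧
      ∀ x y, G.Adj x y ↔ x ≠ y ∧ (x ∈ S ∨ y ∈ S ∨ (x ∉ W ∧ y ∉ W)) := by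
  have hδ := hG.le_card_nbrs
  have hbound : ∀ W : Finset V, ∀ D : ℕ, ∑ w ∈ W, #(nbrs G w) ≤ D →
      N * N + b + #Wᶜ ≤ #Wᶜ * #Wᶜ + 2 * D + N := by
    intro W D hD
    have := sum_card_nbrs_add_le G W
    omega
  have hcompl : ∀ W : Finset V, #Wᶜ + #W = N + b := fun W => by
    rw [← hn, add_comm, card_add_card_compl]
  -- A nonadjacent pair of maximal degree sum: every non-neighbour of `v` then has degree at most
  -- that of `u`.
  obtain ⟨u, v, huv, hadj, huv', hmax⟩ : ∃ u v, u ≠ v ∧ ¬ G.Adj u v ∧ #(nbrs G u) ≤ #(nbrs G v) ∧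
      ∀ x, x ≠ v → ¬ G.Adj x v → #(nbrs G x) ≤ #(nbrs G u) := by
    obtain ⟨u, v, huv, hadj⟩ := hG'
    obtain ⟨⟨x, y⟩, hxy, hmax⟩ := exists_max_image
      (univ.filter fun q : V × V => q.1 ≠ q.2 ∧ ¬ G.Adj q.1 q.2)
      (fun q => #(nbrs G q.1) + #(nbrs G q.2)) ⟨(u, v), by simp [huv, hadj]⟩
    simp only [mem_filter, mem_univ, true_and] at hxy hmax
    rcases le_total #(nbrs G x) #(nbrs G y) with h | h
    · refine ⟨x, y, hxy.1, hxy.2, h, fun z hz hza => ?_⟩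
      have := hmax (z, y) ⟨hz, hza⟩
      simp only at this
      omega
    · refine ⟨y, x, hxy.1.symm, fun h => hxy.2 h.symm, h, fun z hz hza => ?_⟩
      have := hmax (z, x) ⟨hz, hza⟩
      simp only at this
      omega
  obtain ⟨t, ht⟩ : ∃ t, #(nbrs G u) = m + t := ⟨_, (Nat.add_sub_of_le (hδ u)).symm⟩
  have hclo := hcl u v huv hadj
  -- The closure condition gives `d(v) ≤ N - 1 - t`, hence at least `b + t` non-neighbours of `v`,
  -- all of degree at most `m + t`.
  have hcard : b + t ≤ #(insert v (nbrs G v))ᶜ := by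
    have h3 := hcompl (insert v (nbrs G v))
    rw [card_insert_of_notMem (by simp)] at h3
    omega
  obtain ⟨W₀, hW₀, hW₀c⟩ := exists_subset_card_eq hcard
  have hW₀d : ∀ w ∈ W₀, #(nbrs G w) ≤ m + t := by
    intro w hw
    have := hW₀ hw
    rw [mem_compl, mem_insert, not_or, mem_nbrs] at this
    rw [← ht]
    exact hmax w this.1 fun h => this.2 h.symm
  have ht0 : t = 0 := by
    by_contra ht0
    have hb1 := hbound W₀ ((b + t) * (m + t)) (by
      rw [← hW₀c, ← smul_eq_mul]
      exact sum_le_card_nsmul _ _ _ hW₀d)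
    have hc := hcompl W₀
    have e : #W₀ᶜ + t = N := by omega
    have h3 := edge_count_lt (N := N) (b := b) (m := m) (t := t) (by exact_mod_cast hm)
      (by exact_mod_cast hb) (by exact_mod_cast h1) (by exact_mod_cast h2) (by omega) (by omega)
    have e' : ((#W₀ᶜ : ℕ) : ℤ) = N - t := by omega
    zify at hb1
    rw [e'] at hb1
    linarith
  subst ht0
  set L : Finset V := univ.filter (fun x => #(nbrs G x) ≤ m) with hL
  have hLd : ∀ x ∈ L, #(nbrs G x) = m := fun x hx => le_antisymm (mem_filter.1 hx).2 (hδ x)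
  have hbL : b ≤ #L := by
    rw [add_zero] at hW₀c hW₀d
    rw [← hW₀c]
    exact card_le_card fun w hw => mem_filter.2 ⟨mem_univ _, hW₀d w hw⟩
  -- One more vertex of degree `m` would contradict the edge count.
  have hLb : #L = b := by
    by_contra hne
    obtain ⟨W, hWL, hW⟩ := exists_subset_card_eq (show b + 1 ≤ #L by omega)
    have hb1 := hbound W ((b + 1) * m) (by
      rw [← hW, ← smul_eq_mul]
      exact sum_le_card_nsmul _ _ _ fun w hw => (hLd w (hWL hw)).le)
    have hc := hcompl W
    obtain ⟨M, hM⟩ : ∃ M, #Wᶜ = M := ⟨_, rfl⟩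
    have e : N = M + 1 := by omega
    rw [hM] at hb1
    subst e
    nlinarith
  have hLc : #Lᶜ = N := by have := hcompl L; omega
  have hclique : ∀ x y, x ∉ L → y ∉ L → x ≠ y → G.Adj x y := by
    intro x y hx hy hxy
    by_contra hnot
    have h3 := hcl x y hxy hnot
    have hyL : x ∉ insert y L := by simp [hxy, hx]
    have hb1 := hbound (insert x (insert y L)) (N + m + b * m - 1) (by
      rw [sum_insert hyL, sum_insert hy, sum_congr rfl hLd, sum_const, smul_eq_mul, hLb]
      omega)
    have hc := hcompl (insert x (insert y L))
    obtain ⟨M, hM⟩ : ∃ M, #(insert x (insert y L))ᶜ = M := ⟨_, rfl⟩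
    rw [card_insert_of_notMem hyL, card_insert_of_notMem hy, hLb, hM] at hc
    rw [hM] at hb1
    have e : N = M + 2 := by omega
    have e2 : N + m + b * m - 1 = M + 1 + m + b * m := by omega
    rw [e2] at hb1
    subst e
    nlinarith
  -- Such an `x` has degree at least `N`: the rest of the clique and one vertex of `L`. A missing
  -- edge to a vertex of degree `m` would violate the closure condition.
  have hall : ∀ x, x ∉ L → (∃ w ∈ L, G.Adj x w) → ∀ w ∈ L, G.Adj x w := by
    rintro x hx ⟨w, hw, hxw⟩ w' hw'
    by_contra hnot
    have hne : x ≠ w' := by rintro rfl; exact hx hw'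
    have h3 := hcl x w' hne hnot
    rw [hLd w' hw'] at h3
    have hsub : insert w (Lᶜ.erase x) ⊆ nbrs G x := by
      intro y hy
      rw [mem_nbrs]
      rcases mem_insert.1 hy with rfl | hy
      · exact hxw
      · rw [mem_erase, mem_compl] at hy
        exact hclique x y hx hy.2 hy.1.symm
    have h4 := card_le_card hsub
    rw [card_insert_of_notMem (by simp [hw]), card_erase_of_mem (mem_compl.2 hx), hLc] at h4
    omega
  set S : Finset V := Lᶜ.filter (fun x => ∃ w ∈ L, G.Adj x w) with hS
  have hSL : Disjoint S L := by
    rw [Finset.disjoint_left]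
    intro x hx hx'
    exact mem_compl.1 (mem_filter.1 hx).1 hx'
  have hSsub : ∀ w ∈ L, S ⊆ nbrs G w := by
    intro w hw x hx
    rw [hS, mem_filter, mem_compl] at hx
    exact mem_nbrs.2 (hall x hx.1 hx.2 w hw).symm
  obtain ⟨w₀, hw₀⟩ : L.Nonempty := card_pos.1 (by omega)
  have hSm : #S ≤ m := (card_le_card (hSsub w₀ hw₀)).trans (hLd w₀ hw₀).le
  -- `S` separates `L` from the remaining vertices of the clique.
  have hmS : m ≤ #S := by
    obtain ⟨x₀, hx₀, hx₀S⟩ := exists_mem_notMem_of_card_lt_card (show #S < #Lᶜ by omega)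
    refine hG.le_card_of_separates (P := fun x => x ∈ L) (a := w₀) (b := x₀)
      (Finset.disjoint_right.1 hSL hw₀) hx₀S hw₀ (mem_compl.1 hx₀) ?_
    intro x y _ hy hx hxy
    by_contra hyL
    exact hy (mem_filter.2 ⟨mem_compl.2 hyL, x, hx, hxy.symm⟩)
  have hSn : ∀ w ∈ L, nbrs G w = S := fun w hw =>
    (eq_of_subset_of_card_le (hSsub w hw) (by rw [hLd w hw]; exact hmS)).symm
  refine ⟨S, L, hSL, le_antisymm hSm hmS, hLb, fun x y => ?_⟩
  by_cases hx : x ∈ L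
  · have hxS := Finset.disjoint_right.1 hSL hx
    rw [← mem_nbrs, hSn x hx]
    constructor
    · exact fun hy => ⟨fun h => hxS (h ▸ hy), Or.inr (Or.inl hy)⟩
    · rintro ⟨_, h | h | h⟩
      · exact absurd h hxS
      · exact h
      · exact absurd hx h.1
  · by_cases hy : y ∈ L
    · have hyS := Finset.disjoint_right.1 hSL hy
      rw [G.adj_comm, ← mem_nbrs, hSn y hy]
      constructor
      · exact fun hx' => ⟨fun h => hyS (h ▸ hx'), Or.inl hx'⟩
      · rintro ⟨_, h | h | h⟩
        · exact h
        · exact absurd h hyS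
        · exact absurd hy h.2
    · exact ⟨fun h => ⟨h.ne, Or.inr (Or.inr ⟨hx, hy⟩)⟩, fun h => hclique x y hx hy h.1⟩

end

/-! ### The extremal graph and its lack of spanning `k`-trees -/

/-- The part of `K_m ∨ (K_a + I_b)` in which a vertex lies. -/
def part (m a b : ℕ) : Fin m ⊕ (Fin a ⊕ Fin b) → Fin 3 :=
  Sum.elim (fun _ => 0) (Sum.elim (fun _ => 1) (fun _ => 2))

lemma joinGraph_adj {m a b : ℕ} {x y : Fin m ⊕ (Fin a ⊕ Fin b)} :
    (joinGraph m a b).Adj x y ↔ x ≠ y ∧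
      (part m a b x = 0 ∨ part m a b y = 0 ∨ (part m a b x ≠ 2 ∧ part m a b y ≠ 2)) := by
  rcases x with x | x | x <;> rcases y with y | y | y <;>
    simp [joinGraph, join, part, completeBipartiteGraph]

lemma card_part_zero (m a b : ℕ) : #(univ.filter fun x => part m a b x = 0) = m := by
  have : (univ.filter fun x => part m a b x = 0) = univ.map Function.Embedding.inl := by
    ext x; rw [mem_filter]; rcases x with x | x | x <;> simp [part]
  rw [this, card_map, card_univ, Fintype.card_fin]

lemma card_part_two (m a b : ℕ) : #(univ.filter fun x => part m a b x = 2) = b := by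
  have : (univ.filter fun x => part m a b x = 2) =
      univ.map (Function.Embedding.inr.trans Function.Embedding.inr) := by
    ext x; rw [mem_filter]; rcases x with x | x | x <;> simp [part]
  rw [this, card_map, card_univ, Fintype.card_fin]

lemma card_part_one (m a b : ℕ) : #(univ.filter fun x => part m a b x = 1) = a := by
  have : (univ.filter fun x => part m a b x = 1) =
      univ.map (Function.Embedding.inl.trans Function.Embedding.inr) := by
    ext x; rw [mem_filter]; rcases x with x | x | x <;> simp [part]
  rw [this, card_map, card_univ, Fintype.card_fin]

variable {V : Type*} [Fintype V]

lemma nonempty_iso_joinGraph {G : SimpleGraph V} {m a b : ℕ} (hn : Fintype.card V = m + a + b)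
    {S W : Finset V} (hSW : Disjoint S W) (hS : #S = m) (hW : #W = b)
    (hG : ∀ x y, G.Adj x y ↔ x ≠ y ∧ (x ∈ S ∨ y ∈ S ∨ (x ∉ W ∧ y ∉ W))) :
    Nonempty (G ≃g joinGraph m a b) := by
  set f : V → Fin 3 := fun x => if x ∈ S then 0 else if x ∈ W then 2 else 1 with hf
  have f0 : ∀ x, f x = 0 ↔ x ∈ S := by
    intro x; simp only [hf]; split_ifs <;> simp [*]
  have f2 : ∀ x, f x = 2 ↔ x ∈ W := by
    intro x; simp only [hf]
    split_ifs with h1 h2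
    · simp [Finset.disjoint_left.1 hSW h1]
    · simp [h2]
    · simp [h2]
  have c0 : #(univ.filter fun x => f x = 0) = m := by
    rw [← hS]; congr 1; ext x; simp [f0]
  have c2 : #(univ.filter fun x => f x = 2) = b := by
    rw [← hW]; congr 1; ext x; simp [f2]
  have c1 : #(univ.filter fun x => f x = 1) = a := by
    have h := card_eq_sum_card_fiberwise (s := (univ : Finset V)) (t := (univ : Finset (Fin 3)))
      (f := f) (fun x _ => mem_univ _)
    rw [Fin.sum_univ_three, card_univ, hn, c0, c2] at h
    omega
  have hfib : ∀ c, Nonempty ({x // f x = c} ≃ {y // part m a b y = c}) := by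
    intro c
    refine ⟨Fintype.equivOfCardEq ?_⟩
    rw [Fintype.card_subtype, Fintype.card_subtype]
    fin_cases c
    · exact c0.trans (card_part_zero m a b).symm
    · exact c1.trans (card_part_one m a b).symm
    · exact c2.trans (card_part_two m a b).symm
  choose e he using fun c => (⟨(hfib c).some, trivial⟩ : ∃ _ : {x // f x = c} ≃
    {y // part m a b y = c}, True)
  refine ⟨⟨Equiv.ofFiberEquiv e, ?_⟩⟩
  intro x y
  have hg : ∀ x, part m a b (Equiv.ofFiberEquiv e x) = f x := Equiv.ofFiberEquiv_map e
  rw [joinGraph_adj, hg, hg, hG, f0, f0, Ne, Ne, Ne, Ne,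
    f2, f2, (Equiv.ofFiberEquiv e).apply_eq_iff_eq]

lemma card_nbrs_comap_le {U : Type*} [Fintype U] (f : V ↪ U) (T : SimpleGraph U) (v : V) :
    #(nbrs (T.comap f) v) ≤ #(nbrs T (f v)) :=
  card_le_card_of_injOn f (fun w hw => by simpa using hw) f.injective.injOn

lemma HasSpanningKTree.of_iso {U : Type*} [Fintype U] {G : SimpleGraph V} {H : SimpleGraph U}
    (e : G ≃g H) {k : ℕ} (h : HasSpanningKTree H k) : HasSpanningKTree G k := by
  obtain ⟨T, hTH, hT, hd⟩ := hasSpanningKTree_iff.1 h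
  refine hasSpanningKTree_of_connected (C := T.comap e.toEquiv.toEmbedding) ?_ ?_ ?_
  · intro a b hab
    exact e.map_adj_iff.1 (hTH hab)
  · exact (Iso.comap e.toEquiv T).connected_iff.2 hT.connected
  · exact fun v => (card_nbrs_comap_le _ _ _).trans (hd _)

/-- A Hamiltonian path suffices. This ensures that a maximal graph without a spanning `k`-tree has a
nonadjacent pair. -/
lemma hasSpanningKTree_top [Nonempty V] {k : ℕ} (hk : 2 ≤ k) :
    HasSpanningKTree (⊤ : SimpleGraph V) k := by
  obtain ⟨n, hn⟩ := Nat.exists_eq_succ_of_ne_zero (Fintype.card_ne_zero (α := V))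
  have e : V ≃ Fin (n + 1) := Fintype.equivFinOfCardEq hn
  refine hasSpanningKTree_of_connected (C := (pathGraph (n + 1)).comap e.toEmbedding) le_top
    ((Iso.comap e (pathGraph (n + 1))).connected_iff.2 (pathGraph_connected n)) fun v => ?_
  refine (card_nbrs_comap_le _ _ _).trans (le_trans ?_ hk)
  have hsub : (nbrs (pathGraph (n + 1)) (e v)).map Fin.valEmbedding ⊆
      {(e v : ℕ) + 1, (e v : ℕ) - 1} := by
    intro j hj
    simp only [mem_map, mem_nbrs, pathGraph_adj, Fin.valEmbedding_apply] at hj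
    obtain ⟨i, hi, rfl⟩ := hj
    simp only [mem_insert, mem_singleton]
    omega
  have := card_le_card hsub
  rw [card_map] at this
  exact this.trans card_le_two

/-- In a tree of maximum degree at most `k`, rooted at a vertex of `S`, at most
`(k - 1) * #S + 1` vertices have their parent in `S`. -/
lemma card_filter_parent_mem_le {T : SimpleGraph V} (hT : T.Connected) {k : ℕ}
    (hk : ∀ v, #(nbrs T v) ≤ k) (hk1 : 1 ≤ k) {s : V} {p : V → V} {h : V → ℕ}
    (hp : IsParent T s p h)
    {S : Finset V} (hs : s ∈ S) :
    #(univ.filter fun z => z ≠ s ∧ p z ∈ S) ≤ (k - 1) * #S + 1 := by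
  set child : V → Finset V := fun x => univ.filter (fun z => z ≠ s ∧ p z = x) with hchild
  have hr : ∀ z, T.Reachable s z := fun z => hT.preconnected s z
  have hsub : ∀ x, child x ⊆ nbrs T x := by
    intro x z hz
    simp only [hchild, mem_filter, mem_univ, true_and] at hz
    rw [mem_nbrs, ← hz.2]
    exact (hp.adj z (hr z) hz.1).symm
  -- Only the root may have `k` children; any other vertex spends one degree on its parent.
  have hle : ∀ x ∈ S.erase s, #(child x) ≤ k - 1 := by
    intro x hx
    have hxs := (mem_erase.1 hx).1
    have hadj := hp.adj x (hr x) hxs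
    have : child x ⊆ (nbrs T x).erase (p x) := by
      intro z hz
      refine mem_erase.2 ⟨?_, hsub x hz⟩
      rintro rfl
      simp only [hchild, mem_filter, mem_univ, true_and] at hz
      have h1 := hp.lt x (hr x) hxs
      have h2 := hp.lt (p x) (hr _) hz.1
      rw [hz.2] at h2
      omega
    have h1 := card_le_card this
    rw [card_erase_of_mem (mem_nbrs.2 hadj)] at h1
    exact h1.trans (Nat.sub_le_sub_right (hk x) 1)
  have hU : (univ.filter fun z => z ≠ s ∧ p z ∈ S) ⊆ child s ∪ (S.erase s).biUnion child := by
    intro z hz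
    simp only [mem_filter, mem_univ, true_and] at hz
    rw [mem_union, mem_biUnion]
    by_cases hzs : p z = s
    · left; simp [hchild, hz.1, hzs]
    · exact Or.inr ⟨p z, mem_erase.2 ⟨hzs, hz.2⟩, by simp [hchild, hz.1]⟩
  have h1 := (card_le_card hU).trans (card_union_le _ _)
  have h2 : #((S.erase s).biUnion child) ≤ #(S.erase s) * (k - 1) := card_biUnion_le_card_mul _ _ _ hle
  have h3 := (card_le_card (hsub s)).trans (hk s)
  rw [card_erase_of_mem hs] at h2
  obtain ⟨q, hq⟩ : ∃ q, #S = q + 1 := ⟨#S - 1, by have := card_pos.2 ⟨s, hs⟩; omega⟩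
  rw [hq] at h2 ⊢
  rw [Nat.add_sub_cancel] at h2
  have e : (k - 1) * (q + 1) = q * (k - 1) + (k - 1) := by ring
  omega

/-- Root the tree in `K_m`. All `b` vertices of `I_b`, and a vertex of `K_a` of least height, have
their parent in `K_m`; that is one vertex more than `(k-1)m + 1` allows. -/
lemma not_hasSpanningKTree_joinGraph {m a b k : ℕ} (hm : 1 ≤ m) (ha : 1 ≤ a) (hk : 1 ≤ k)
    (hb : (k - 1) * m + 1 ≤ b) : ¬ HasSpanningKTree (joinGraph m a b) k := by
  intro hT
  obtain ⟨T, hTH, hT, hd⟩ := hasSpanningKTree_iff.1 hT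
  set s : Fin m ⊕ (Fin a ⊕ Fin b) := Sum.inl ⟨0, hm⟩ with hs
  obtain ⟨p, h, hp⟩ := exists_isParent T s
  have hr : ∀ z, T.Reachable s z := fun z => hT.connected.preconnected s z
  have hs0 : part m a b s = 0 := rfl
  have hle := card_filter_parent_mem_le hT.connected hd hk hp
    (S := univ.filter fun x => part m a b x = 0) (by simp [hs0])
  rw [card_part_zero] at hle
  obtain ⟨z, hz, hmin⟩ := exists_min_image (univ.filter fun x => part m a b x = 1) h
    (card_pos.1 (by rw [card_part_one]; exact ha))
  have hz1 := (mem_filter.1 hz).2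
  have hadj : ∀ x, part m a b x ≠ 0 → x ≠ s ∧ (joinGraph m a b).Adj x (p x) ∧ h (p x) < h x := by
    intro x hx
    have hxs : x ≠ s := by rintro rfl; exact hx hs0
    exact ⟨hxs, hTH (hp.adj x (hr x) hxs), hp.lt x (hr x) hxs⟩
  have hsub : insert z (univ.filter fun x => part m a b x = 2) ⊆
      univ.filter fun x => x ≠ s ∧ p x ∈ univ.filter fun x => part m a b x = 0 := by
    intro x hx
    simp only [mem_filter, mem_univ, true_and]
    rcases mem_insert.1 hx with rfl | hx
    · obtain ⟨h1, h2, h3⟩ := hadj x (by rw [hz1]; decide)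
      refine ⟨h1, ?_⟩
      have h4 : part m a b (p x) ≠ 1 := by
        intro h4
        have := hmin (p x) (by simpa using h4)
        omega
      rw [joinGraph_adj] at h2
      have h5 : part m a b (p x) = 0 ∨ part m a b (p x) ≠ 2 := by
        rcases h2.2 with h | h | h
        · rw [hz1] at h; exact absurd h (by decide)
        · exact Or.inl h
        · exact Or.inr h.2
      generalize part m a b (p x) = c at h4 h5
      fin_cases c <;> simp_all
    · have hx2 := (mem_filter.1 hx).2
      obtain ⟨h1, h2, h3⟩ := hadj x (by rw [hx2]; decide)
      refine ⟨h1, ?_⟩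
      rw [joinGraph_adj] at h2
      rcases h2.2 with h | h | h
      · rw [hx2] at h; exact absurd h (by decide)
      · exact h
      · exact absurd hx2 h.1
  have := (card_le_card hsub).trans (le_of_eq_of_le (by congr!) hle)
  rw [card_insert_of_notMem (by simp [hz1]), card_part_two] at this
  omega

/-! ### Passing to an edge-maximal supergraph -/

/-- A dense `m`-connected graph without spanning `k`-tree is contained in a copy of the
extremal graph. -/
theorem exists_le_iso_joinGraph {G : SimpleGraph V} {m k a b : ℕ} (hm : 1 ≤ m) (hk : 2 ≤ k)
    (hb : b = (k - 1) * m + 1) (hn : Fintype.card V = m + a + b) (hG : IsMConnected G m)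
    (hno : ¬ HasSpanningKTree G k)
    (h1 : 2 * b * m + b + 2 * m + 6 ≤ 2 * (m + a)) (h2 : 6 * b + 5 * m ≤ m + a + 3)
    (hsum : (m + a) * (m + a) + b ≤ ∑ v, #(nbrs G v) + (m + a)) :
    ∃ G', G ≤ G' ∧ Nonempty (G' ≃g joinGraph m a b) := by
  obtain ⟨G', hGG', hmax⟩ := (Set.toFinite {H : SimpleGraph V | ¬ HasSpanningKTree H k}).exists_le_maximal
    (show G ∈ {H : SimpleGraph V | ¬ HasSpanningKTree H k} from hno)
  have hno' : ¬ HasSpanningKTree G' k := hmax.prop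
  have hG' := hG.mono hGG'
  have hne : Nonempty V := (hG.connected hm).nonempty
  obtain ⟨l, rfl⟩ : ∃ l, k = l + 2 := ⟨k - 2, by omega⟩
  have e1 : l + 2 - 1 = l + 1 := by omega
  rw [e1] at hb
  have hlm : b = l * m + m + 1 := by rw [hb]; ring
  obtain ⟨S, W, hSW, hS, hW, hadj⟩ := exists_structure_of_closed (G := G') (N := m + a) (b := b) hm
    (by omega) hn hG' (by
      by_contra hcon
      push Not at hcon
      refine hno' ?_
      have : G' = ⊤ := by
        ext x y
        exact ⟨fun h => h.ne, fun h => hcon x y h⟩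
      rw [this]
      exact hasSpanningKTree_top hk) h1 h2 (by
      intro u v huv hadj
      have hT : HasSpanningKTree (G' ⊔ edge u v) (l + 2) := by
        by_contra hT
        have hle := hmax.le_of_ge (show G' ⊔ edge u v ∈ _ from hT) le_sup_left
        refine hadj (hle ?_)
        rw [sup_adj, edge_adj]
        exact Or.inr ⟨Or.inl ⟨rfl, rfl⟩, huv⟩
      have := degree_add_degree_le_of_hasSpanningKTree_sup_edge hk hG' hno' hadj hT
      rw [Nat.add_sub_cancel] at this
      omega) (hsum.trans (Nat.add_le_add_right
        (sum_le_sum fun v _ => card_le_card (nbrs_mono hGG' v)) _))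
  exact ⟨G', hGG', nonempty_iso_joinGraph hn hSW hS hW hadj⟩

/-! ### Spectral radius: Rayleigh bound, strict monotonicity, Hong's bound -/

lemma adjMatrix_mulVec_eq (G : SimpleGraph V) (x : V → ℝ) (v : V) :
    (G.adjMatrix ℝ).mulVec x v = ∑ w ∈ nbrs G v, x w := by
  rw [adjMatrix_mulVec_apply]
  refine sum_congr ?_ fun _ _ => rfl
  ext w
  simp

lemma hasEigenvalue_adjMatrix_iff (G : SimpleGraph V) (μ : ℝ) :
    Module.End.HasEigenvalue (Matrix.toLin' (G.adjMatrix ℝ)) μ ↔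
      ∃ x : V → ℝ, x ≠ 0 ∧ ∀ v, ∑ w ∈ nbrs G v, x w = μ * x v := by
  constructor
  · intro h
    obtain ⟨x, hx⟩ := h.exists_hasEigenvector
    refine ⟨x, hx.2, fun v => ?_⟩
    have := congrFun hx.apply_eq_smul v
    rwa [Matrix.toLin'_apply, adjMatrix_mulVec_eq] at this
  · rintro ⟨x, hx, h⟩
    refine Module.End.hasEigenvalue_of_hasEigenvector (x := x)
      (Module.End.hasEigenvector_iff.2 ⟨Module.End.mem_eigenspace_iff.2 ?_, hx⟩)
    funext v
    rw [Matrix.toLin'_apply, adjMatrix_mulVec_eq, h]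
    rfl

lemma isHermitian_adjMatrix {V : Type*} (G : SimpleGraph V) : (G.adjMatrix ℝ).IsHermitian := by
  rw [Matrix.IsHermitian, Matrix.conjTranspose_eq_transpose_of_trivial]
  exact G.isSymm_adjMatrix

lemma finite_eigenvalues (G : SimpleGraph V) :
    {μ : ℝ | Module.End.HasEigenvalue (Matrix.toLin' (G.adjMatrix ℝ)) μ}.Finite := by
  simp only [Module.End.hasEigenvalue_iff_mem_spectrum]
  exact Module.End.finite_spectrum _

/-- The eigenvalue set is finite and nonempty, so the supremum is attained and is not a default
value. -/
lemma specRadius_mem [Nonempty V] (G : SimpleGraph V) :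
    Module.End.HasEigenvalue (Matrix.toLin' (G.adjMatrix ℝ)) (specRadius G) := by
  refine Set.Nonempty.csSup_mem (s := {μ : ℝ | Module.End.HasEigenvalue
    (Matrix.toLin' (G.adjMatrix ℝ)) μ}) ?_ (finite_eigenvalues G)
  obtain ⟨i⟩ := ‹Nonempty V›
  refine ⟨(isHermitian_adjMatrix G).eigenvalues i, ?_⟩
  rw [Set.mem_ofPred_eq, Module.End.hasEigenvalue_iff_mem_spectrum, Matrix.spectrum_toLin']
  exact (isHermitian_adjMatrix G).eigenvalues_mem_spectrum_real i

lemma le_specRadius (G : SimpleGraph V) {μ : ℝ}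
    (h : Module.End.HasEigenvalue (Matrix.toLin' (G.adjMatrix ℝ)) μ) : μ ≤ specRadius G :=
  le_csSup (finite_eigenvalues G).bddAbove h

lemma posSemidef_specRadius_sub (G : SimpleGraph V) :
    (specRadius G • (1 : Matrix V V ℝ) - G.adjMatrix ℝ).PosSemidef := by
  have hH : (specRadius G • (1 : Matrix V V ℝ) - G.adjMatrix ℝ).IsHermitian := by
    refine Matrix.IsHermitian.sub ?_ (isHermitian_adjMatrix G)
    rw [Matrix.IsHermitian, Matrix.conjTranspose_smul, Matrix.conjTranspose_one, star_trivial]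
  rw [hH.posSemidef_iff_eigenvalues_nonneg]
  intro i
  have h1 : Module.End.HasEigenvalue
      (Matrix.toLin' (specRadius G • (1 : Matrix V V ℝ) - G.adjMatrix ℝ)) (hH.eigenvalues i) := by
    rw [Module.End.hasEigenvalue_iff_mem_spectrum, Matrix.spectrum_toLin']
    exact hH.eigenvalues_mem_spectrum_real i
  obtain ⟨x, hx⟩ := h1.exists_hasEigenvector
  have h2 := le_specRadius G (μ := specRadius G - hH.eigenvalues i) (by
    rw [hasEigenvalue_adjMatrix_iff]
    refine ⟨x, hx.2, fun v => ?_⟩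
    have := congrFun hx.apply_eq_smul v
    rw [Matrix.toLin'_apply, Matrix.sub_mulVec, Pi.sub_apply, adjMatrix_mulVec_eq,
      Matrix.smul_mulVec, Matrix.one_mulVec, Pi.smul_apply, Pi.smul_apply, smul_eq_mul,
      smul_eq_mul] at this
    linarith)
  simp only [Pi.zero_apply]
  linarith

lemma dotProduct_specRadius_sub (G : SimpleGraph V) (x : V → ℝ) :
    star x ⬝ᵥ (specRadius G • (1 : Matrix V V ℝ) - G.adjMatrix ℝ).mulVec x =
      specRadius G * ∑ v, x v ^ 2 - ∑ v, ∑ w ∈ nbrs G v, x v * x w := by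
  rw [Matrix.sub_mulVec, dotProduct_sub, star_trivial]
  congr 1
  · rw [Matrix.smul_mulVec, Matrix.one_mulVec, dotProduct_smul, smul_eq_mul]
    simp [dotProduct, sq]
  · simp only [dotProduct, adjMatrix_mulVec_eq, mul_sum]

/-- The Rayleigh bound. -/
lemma quadratic_le_specRadius (G : SimpleGraph V) (x : V → ℝ) :
    ∑ v, ∑ w ∈ nbrs G v, x v * x w ≤ specRadius G * ∑ v, x v ^ 2 := by
  have := (posSemidef_specRadius_sub G).dotProduct_mulVec_nonneg x
  rw [dotProduct_specRadius_sub] at this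
  linarith

/-- Equality in the Rayleigh bound puts `x` in the kernel of the positive semidefinite matrix `ρ -
A`. -/
lemma eigen_of_quadratic_eq (G : SimpleGraph V) (x : V → ℝ)
    (h : specRadius G * ∑ v, x v ^ 2 ≤ ∑ v, ∑ w ∈ nbrs G v, x v * x w) (v : V) :
    ∑ w ∈ nbrs G v, x w = specRadius G * x v := by
  have h0 : star x ⬝ᵥ (specRadius G • (1 : Matrix V V ℝ) - G.adjMatrix ℝ).mulVec x = 0 := by
    rw [dotProduct_specRadius_sub]
    linarith [quadratic_le_specRadius G x]
  rw [(posSemidef_specRadius_sub G).dotProduct_mulVec_zero_iff] at h0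
  have := congrFun h0 v
  rw [Matrix.sub_mulVec, Pi.sub_apply, adjMatrix_mulVec_eq, Matrix.smul_mulVec,
    Matrix.one_mulVec, Pi.smul_apply, smul_eq_mul, Pi.zero_apply] at this
  linarith

/-- Adding edges strictly increases the largest eigenvalue if the result is connected. -/
theorem eq_of_specRadius_le {G H : SimpleGraph V} (hGH : G ≤ H) (hH : H.Connected)
    (h : specRadius H ≤ specRadius G) : G = H := by
  have hne : Nonempty V := hH.nonempty
  obtain ⟨x, hx0, hx⟩ := (hasEigenvalue_adjMatrix_iff G _).1 (specRadius_mem G)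
  -- Absolute values do not decrease the quadratic form, so `y` attains the Rayleigh bound in `H`
  -- too and is an eigenvector of `H`.
  set y : V → ℝ := fun v => |x v| with hy
  have hy0 : ∀ v, 0 ≤ y v := fun v => abs_nonneg _
  have h1 : specRadius G * ∑ v, y v ^ 2 ≤ ∑ v, ∑ w ∈ nbrs G v, y v * y w := by
    have e : specRadius G * ∑ v, y v ^ 2 = ∑ v, ∑ w ∈ nbrs G v, x v * x w := by
      rw [mul_sum]
      refine sum_congr rfl fun v _ => ?_
      rw [← mul_sum, hx v, hy]
      simp only [sq_abs]
      ring
    rw [e]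
    refine sum_le_sum fun v _ => sum_le_sum fun w _ => ?_
    rw [hy]
    simp only [← abs_mul]
    exact le_abs_self _
  have h2 : ∀ v, ∑ w ∈ nbrs G v, y v * y w ≤ ∑ w ∈ nbrs H v, y v * y w := fun v =>
    sum_le_sum_of_subset_of_nonneg (nbrs_mono hGH v)
      fun w _ _ => mul_nonneg (hy0 v) (hy0 w)
  have h3 : specRadius H * ∑ v, y v ^ 2 ≤ specRadius G * ∑ v, y v ^ 2 :=
    mul_le_mul_of_nonneg_right h (sum_nonneg fun v _ => sq_nonneg _)
  have h4 := sum_le_sum (s := univ) fun v _ => h2 v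
  have h5 := quadratic_le_specRadius H y
  have hev := eigen_of_quadratic_eq H y (by linarith)
  -- A zero of a nonnegative eigenvector spreads to its neighbours, hence over all of the connected
  -- `H`.
  have hpos : ∀ v, y v ≠ 0 := by
    by_contra hcon
    push Not at hcon
    obtain ⟨v, hv⟩ := hcon
    have hstep : ∀ a b, H.Adj a b → y a = 0 → y b = 0 := by
      intro a b hab ha
      have := hev a
      rw [ha, mul_zero, sum_eq_zero_iff_of_nonneg fun w _ => hy0 w] at this
      exact this b (mem_nbrs.2 hab)
    have hwalk : ∀ a b, H.Walk a b → y a = 0 → y b = 0 := by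
      intro a b w
      induction w with
      | nil => exact id
      | cons hac _ ih => exact fun ha => ih (hstep _ _ hac ha)
    refine hx0 (funext fun w => ?_)
    obtain ⟨p⟩ := hH.preconnected v w
    exact abs_eq_zero.1 (hwalk v w p hv)
  have h6 : ∑ v, ∑ w ∈ nbrs G v, y v * y w = ∑ v, ∑ w ∈ nbrs H v, y v * y w :=
    le_antisymm h4 (by linarith)
  rw [sum_eq_sum_iff_of_le fun v _ => h2 v] at h6
  refine le_antisymm hGH fun a b hab => ?_
  by_contra hnot
  have h7 : ∑ w ∈ nbrs G a, y a * y w < ∑ w ∈ nbrs H a, y a * y w :=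
    sum_lt_sum_of_subset (nbrs_mono hGH a) (mem_nbrs.2 hab) (by simpa using hnot)
      (mul_pos ((hy0 a).lt_of_ne' (hpos a)) ((hy0 b).lt_of_ne' (hpos b)))
      fun w _ _ => mul_nonneg (hy0 a) (hy0 w)
  exact h7.ne (h6 a (mem_univ a))

lemma hasEigenvalue_adjMatrix_of_iso {U : Type*} [Fintype U] {G : SimpleGraph V}
    {H : SimpleGraph U} (e : G ≃g H) {μ : ℝ}
    (h : Module.End.HasEigenvalue (Matrix.toLin' (G.adjMatrix ℝ)) μ) :
    Module.End.HasEigenvalue (Matrix.toLin' (H.adjMatrix ℝ)) μ := by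
  rw [hasEigenvalue_adjMatrix_iff] at h ⊢
  obtain ⟨x, hx, hμ⟩ := h
  refine ⟨fun u => x (e.symm u), fun h => hx (funext fun v => ?_), fun v => ?_⟩
  · simpa using congrFun h (e v)
  · rw [← hμ]
    refine sum_equiv e.symm.toEquiv (fun w => ?_) fun w _ => rfl
    rw [mem_nbrs, mem_nbrs]
    exact e.symm.map_adj_iff.symm

lemma specRadius_eq_of_iso {U : Type*} [Fintype U] {G : SimpleGraph V} {H : SimpleGraph U}
    (e : G ≃g H) : specRadius G = specRadius H := by
  have h : {μ : ℝ | Module.End.HasEigenvalue (Matrix.toLin' (G.adjMatrix ℝ)) μ} =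
      {μ : ℝ | Module.End.HasEigenvalue (Matrix.toLin' (H.adjMatrix ℝ)) μ} := Set.ext fun _ =>
    ⟨hasEigenvalue_adjMatrix_of_iso e, hasEigenvalue_adjMatrix_of_iso e.symm⟩
  exact congrArg sSup h

/-- Hong's bound `ρ² ≤ 2e - n + 1` for graphs without isolated vertices. -/
theorem sq_eigenvalue_add_le {G : SimpleGraph V} (hδ : ∀ v, 1 ≤ #(nbrs G v)) {μ : ℝ}
    (hμ : Module.End.HasEigenvalue (Matrix.toLin' (G.adjMatrix ℝ)) μ) :
    μ ^ 2 + Fintype.card V ≤ ∑ v, (#(nbrs G v) : ℝ) + 1 := by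
  obtain ⟨x, hx0, hx⟩ := (hasEigenvalue_adjMatrix_iff G μ).1 hμ
  set s := ∑ v, x v ^ 2 with hs
  have hspos : 0 < s := by
    obtain ⟨v, hv⟩ := Function.ne_iff.1 hx0
    exact sum_pos' (fun _ _ => sq_nonneg _) ⟨v, mem_univ _, by positivity [show x v ≠ 0 from hv]⟩
  -- Cauchy–Schwarz on the neighbourhood of `v`; the factor `d(v) - 1 ≥ 0` lets the mass outside the
  -- neighbourhood be bounded below by `x v ^ 2`. On summation the degree-weighted squares cancel.
  have hrow : ∀ v, μ ^ 2 * x v ^ 2 ≤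
      #(nbrs G v) * s - (#(nbrs G v) - 1) * x v ^ 2 - (s - ∑ w ∈ nbrs G v, x w ^ 2) := by
    intro v
    have h1 : (μ * x v) ^ 2 ≤ #(nbrs G v) * ∑ w ∈ nbrs G v, x w ^ 2 := by
      rw [← hx v]
      exact sq_sum_le_card_mul_sum_sq
    have h2 : x v ^ 2 + ∑ w ∈ nbrs G v, x w ^ 2 ≤ s := by
      rw [← sum_insert (f := fun w => x w ^ 2) (by simp : v ∉ nbrs G v)]
      exact sum_le_univ_sum_of_nonneg fun _ => sq_nonneg _
    have h3 : (1 : ℝ) ≤ #(nbrs G v) := by exact_mod_cast hδ v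
    nlinarith
  have hsum := sum_le_sum (s := univ) fun v _ => hrow v
  have hswap : ∑ v, ∑ w ∈ nbrs G v, x w ^ 2 = ∑ v, #(nbrs G v) * x v ^ 2 := by
    simp only [nbrs, sum_filter]
    rw [sum_comm]
    refine sum_congr rfl fun w _ => ?_
    rw [← sum_filter, sum_const, nsmul_eq_mul]
    simp only [G.adj_comm]
  rw [← mul_sum, sum_sub_distrib, sum_sub_distrib, sum_sub_distrib, hswap, ← sum_mul] at hsum
  simp only [sub_mul, one_mul, sum_sub_distrib, sum_const, card_univ, nsmul_eq_mul] at hsum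
  rw [← hs] at hsum
  have : (μ ^ 2 + Fintype.card V) * s ≤ (∑ v, (#(nbrs G v) : ℝ) + 1) * s := by linarith
  exact le_of_mul_le_mul_right this hspos

/-- Rayleigh bound for the indicator vector of the clique `K_m ∨ K_a`. -/
lemma le_specRadius_joinGraph {m a b : ℕ} (hm : 1 ≤ m) :
    (m + a : ℝ) - 1 ≤ specRadius (joinGraph m a b) := by
  set P : Finset (Fin m ⊕ (Fin a ⊕ Fin b)) := univ.filter fun x => part m a b x ≠ 2 with hP
  have hcard : #P = m + a := by
    have h := card_filter_add_card_filter_not (s := (univ : Finset (Fin m ⊕ (Fin a ⊕ Fin b))))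
      (fun x => part m a b x = 2)
    rw [card_part_two] at h
    simp only [card_univ, Fintype.card_sum, Fintype.card_fin] at h
    have : #P = #(univ.filter fun x => ¬ part m a b x = 2) := rfl
    omega
  have h := quadratic_le_specRadius (joinGraph m a b) (fun x => if x ∈ P then 1 else 0)
  have h1 : ∑ x, (if x ∈ P then (1 : ℝ) else 0) ^ 2 = m + a := by
    simp only [ite_pow, one_pow, ne_eq, OfNat.ofNat_ne_zero, not_false_eq_true, zero_pow]
    rw [sum_ite_mem, univ_inter, sum_const, hcard]
    simp
  have h2 : ∀ x, (if x ∈ P then ((m + a : ℝ) - 1) else 0) ≤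
      ∑ y ∈ nbrs (joinGraph m a b) x,
        (if x ∈ P then (1 : ℝ) else 0) * (if y ∈ P then 1 else 0) := by
    intro x
    by_cases hx : x ∈ P
    · simp only [hx, if_true, one_mul]
      rw [sum_ite_mem, sum_const, nsmul_eq_mul, mul_one]
      have hsub : P.erase x ⊆ nbrs (joinGraph m a b) x ∩ P := by
        intro y hy
        rw [mem_erase] at hy
        rw [mem_inter, mem_nbrs, joinGraph_adj]
        exact ⟨⟨hy.1.symm, Or.inr (Or.inr ⟨(mem_filter.1 hx).2, (mem_filter.1 hy.2).2⟩)⟩, hy.2⟩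
      have h3 := card_le_card hsub
      rw [card_erase_of_mem hx, hcard] at h3
      have h4 : m + a ≤ #(nbrs (joinGraph m a b) x ∩ P) + 1 := by omega
      have h5 : (m + a : ℝ) ≤ #(nbrs (joinGraph m a b) x ∩ P) + 1 := by exact_mod_cast h4
      linarith
    · simp [hx]
  have h3 := sum_le_sum (s := univ) fun x _ => h2 x
  rw [sum_ite_mem, univ_inter, sum_const, hcard, nsmul_eq_mul] at h3
  rw [h1] at h
  have hpos : (0 : ℝ) < m + a := by
    have : (1 : ℝ) ≤ m := by exact_mod_cast hm
    positivity
  push_cast at h3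
  have h4 := h3.trans h
  rw [mul_comm] at h4
  exact le_of_mul_le_mul_right h4 hpos

end SpanningKTree

/-! ### The main theorem -/

theorem theorem1p11 {V : Type*} [Fintype V] (G : SimpleGraph V) (n m k : ℕ)
    (hm : 1 ≤ m) (hk : 2 ≤ k) (hn : Fintype.card V = n)
    (hbound : max ((7 * (k : ℝ) - 2) * m + 4)
      (((k : ℝ) - 1) * (m : ℝ) ^ 2 + 1 / 2 * (3 * (k : ℝ) + 1) * m + 9 / 2) ≤ (n : ℝ))
    (hconn : SpanningKTree.IsMConnected G m)
    (hρ : SpanningKTree.specRadius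
        (SpanningKTree.joinGraph m (n - k * m - 1) (k * m - m + 1)) ≤
      SpanningKTree.specRadius G) :
    SpanningKTree.HasSpanningKTree G k ↔
      ¬ Nonempty (G ≃g SpanningKTree.joinGraph m (n - k * m - 1) (k * m - m + 1)) := by
  obtain ⟨l, rfl⟩ : ∃ l, k = l + 2 := ⟨k - 2, by omega⟩
  obtain ⟨hb1, hb2⟩ := max_le_iff.1 hbound
  -- With `b = (k-1)m + 1`, the two bounds on `n` are exactly `h2` and `h1` of
  -- `exists_le_iso_joinGraph`.
  have hn1 : 7 * (l * m) + 12 * m + 4 ≤ n := by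
    have : ((7 * (l * m) + 12 * m + 4 : ℕ) : ℝ) ≤ n := by
      push_cast at hb1 ⊢
      linarith
    exact_mod_cast this
  have hn2 : 2 * ((l + 1) * m * m) + 3 * (l * m) + 7 * m + 9 ≤ 2 * n := by
    have : ((2 * ((l + 1) * m * m) + 3 * (l * m) + 7 * m + 9 : ℕ) : ℝ) ≤ ((2 * n : ℕ) : ℝ) := by
      push_cast at hb2 ⊢
      linarith
    exact_mod_cast this
  obtain ⟨b, hb⟩ : ∃ b, (l + 2) * m - m + 1 = b := ⟨_, rfl⟩
  obtain ⟨a, ha⟩ : ∃ a, n - (l + 2) * m - 1 = a := ⟨_, rfl⟩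
  have e : (l + 2) * m = l * m + 2 * m := by ring
  have hbl : b = l * m + m + 1 := by omega
  -- The truncated subtractions are genuine because `n` is large.
  have hab : n = m + a + b := by omega
  rw [ha, hb] at hρ ⊢
  have hbk : b = (l + 2 - 1) * m + 1 := by
    rw [hbl, show l + 2 - 1 = l + 1 by omega]; ring
  constructor
  · rintro hT ⟨e⟩
    exact SpanningKTree.not_hasSpanningKTree_joinGraph hm (by omega) (by omega) hbk.ge
      (hT.of_iso e.symm)
  · intro hiso
    by_contra hno
    have hconn' := hconn.connected hm
    have hne : Nonempty V := hconn'.nonempty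
    have hlow := SpanningKTree.le_specRadius_joinGraph (m := m) (a := a) (b := b) hm
    have hHong := SpanningKTree.sq_eigenvalue_add_le
      (fun v => hm.trans (hconn.le_card_nbrs v)) (SpanningKTree.specRadius_mem G)
    have hm' : (1 : ℝ) ≤ m := by exact_mod_cast hm
    have hsq : ((m + a : ℝ) - 1) ^ 2 ≤ SpanningKTree.specRadius G ^ 2 := by
      refine pow_le_pow_left₀ ?_ (hlow.trans hρ) 2
      have : (0 : ℝ) ≤ a := by positivity
      linarith
    have hsum : (m + a) * (m + a) + b ≤ ∑ v, (SpanningKTree.nbrs G v).card + (m + a) := by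
      have : (((m + a) * (m + a) + b : ℕ) : ℝ) ≤
          ((∑ v, (SpanningKTree.nbrs G v).card + (m + a) : ℕ) : ℝ) := by
        rw [hn, hab] at hHong
        push_cast at hHong ⊢
        linarith
      exact_mod_cast this
    obtain ⟨G', hGG', ⟨i⟩⟩ := SpanningKTree.exists_le_iso_joinGraph hm hk hbk (hn.trans hab) hconn
      hno (by rw [hbl] at hab ⊢; nlinarith) (by omega) hsum
    have hGeq := SpanningKTree.eq_of_specRadius_le hGG' (hconn'.mono hGG')
      ((SpanningKTree.specRadius_eq_of_iso i).le.trans hρ)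
    subst hGeq
    exact hiso ⟨i⟩
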